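/- **Setting.** Let $n\ge 0$ and let $p$ be a real polynomial in $x=(x_1,\dots,x_n)$ of degree at most $4$. Let $\mathcal K$ be the family of the following factors: $x_ix_j$ ($i\le j$), $x_i(1-x_j)$ (all $i,j$), $(1-x_i)(1-x_j)$ ($i\le j$), $x_i$, $1-x_i$ ($i\in[n]$), and $1$. A *decomposition* $Z$ of $p$ attaches to every factor a convex quadratic, $$\begin{aligned}p(x)={}&\sum_{i\le j}x_ix_j\,(x^TP^{ij}x+x^Tr^{ij}+w^{ij})+\sum_{i,j}x_i(1-x_j)\,(x^TQ^{ij}x+x^Tf^{ij}+g^{ij})\\&+\sum_{i\le j}(1-x_i)(1-x_j)\,(x^TT^{ij}x+x^Th^{ij}+s^{ij})+\sum_i x_i\,(x^TP^ix+x^Tr^i+w^i)\\&+\sum_i(1-x_i)\,(x^TQ^ix+x^Tf^i+g^i)+(x^TP'x+x^Tr'+w')\end{aligned}$$ for all $x$, with all matrices symmetric positive semidefinite. Let $\mathcal V$ be the set of all decompositions of $p$, described by these LMIs together with a finite system of linear equations ($l\in[m]$) $$\begin{aligned}&\sum_{i\le j}\Big(\langle\bar A_l^{ij},P^{ij}\rangle+(\bar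 c_l^{ij})^Tr^{ij}+\bar\mu_l^{ij}w^{ij}\Big)+\sum_{i,j}\Big(\langle\bar B_l^{ij},Q^{ij}\rangle+(\bar d_l^{ij})^Tf^{ij}+\bar\nu_l^{ij}g^{ij}\Big)\\&+\sum_{i\le j}\Big(\langle C_l^{ij},T^{ij}\rangle+(e_l^{ij})^Th^{ij}+\xi_l^{ij}s^{ij}\Big)+\sum_i\Big(\langle A_l^i,P^i\rangle+(c_l^i)^Tr^i+\mu_l^iw^i\Big)\\&+\sum_i\Big(\langle B_l^i,Q^i\rangle+(d_l^i)^Tf^i+\nu_l^ig^i\Big)+\langle\Xi_l,P'\rangle+\omega_l^Tr'+\gamma_lw'=q_l,\end{aligned}$$ with symmetric coefficient matrices (for example, the equations that match the coefficients of the monomials of degree at most $4$). The variables are $x\in\mathbb R^n$, $U=(u_{ij})\in\mathbb R^{n\times n}$ with columns $U_i$ (linearizing $xx^T$), and $V=(v_{ij})$ with $v_{ij}\in\mathbb R^n$ (linearizing $u_{ij}x$). Let $\overline{\mathcal X}$ be any set of triples $(x,U,V)$, and write $\theta_{ij}=x-U_i-U_j+v_{ij}$. For $Z\in\mathcal V$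 put $$\begin{aligned}g_4(x,U,V,Z)={}&\sum_{i\le j}\Big(\tfrac{1}{u_{ij}}v_{ij}^TP^{ij}v_{ij}+v_{ij}^Tr^{ij}+u_{ij}w^{ij}\Big)\\&+\sum_{i,j}\Big(\tfrac{1}{x_i-u_{ij}}(U_i-v_{ij})^TQ^{ij}(U_i-v_{ij})+(U_i-v_{ij})^Tf^{ij}+(x_i-u_{ij})g^{ij}\Big)\\&+\sum_{i\le j}\Big(\tfrac{1}{1-x_i-x_j+u_{ij}}\theta_{ij}^TT^{ij}\theta_{ij}+\theta_{ij}^Th^{ij}+(1-x_i-x_j+u_{ij})s^{ij}\Big)\\&+\sum_i\Big(\tfrac1{x_i}U_i^TP^iU_i+U_i^Tr^i+x_iw^i\Big)\\&+\sum_i\Big(\tfrac1{1-x_i}(x-U_i)^TQ^i(x-U_i)+(x-U_i)^Tf^i+(1-x_i)g^i\Big)+x^TP'x+x^Tr'+w'.\end{aligned}$$ Here $\tfrac1t v^TPv$ denotes the closed perspective of $v\mapsto v^TPv$: for $t=0$ it is $0$ if $v^TPv=0$ and $+\infty$ otherwise, and for $t<0$ it is $+\infty$. Consider $$\min_{(x,U,V)\in\overline{\mathcal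 X}}\ \max_{Z\in\mathcal V}\ g_4(x,U,V,Z),\tag{1}$$ where the inner maximum is understood as a supremum in $[-\infty,+\infty]$, and an optimal solution is a point of $\overline{\mathcal X}$ at which this supremum is $<+\infty$ and minimal over $\overline{\mathcal X}$. **Theorem.** $(x,U,V)$ is an optimal solution of (1) if and only if there exist $n\times n$ matrices $Y=(Y^{ij}\,(i\le j),\,Y^i,\,Y^{n+1})$, $R=(R^{ij}\,(\text{all }i,j),\,R^i)$, $E=(E^{ij}\,(i\le j))$ and $\lambda\in\mathbb R^m$ such that $(x,U,V,Y,R,E,\lambda)$ is an optimal solution of the semidefinite program that minimizes $-\sum_{l}\lambda_lq_l$ over all $(x,U,V,Y,R,E,\lambda)$ with $(x,U,V)\in\overline{\mathcal X}$ subject to the following constraints (all sums over $l\in[m]$). For all $i\le j$: $$Y^{ij}+\sum\lambda_l\bar A_l^{ij}\preceq0,\quad v_{ij}+\sum\lambda_l\bar c_l^{ij}=0,\quad u_{ij}+\sum\lambda_l\bar\mu_l^{ij}=0,\quad\begin{pmatrix}Y^{ij}&v_{ij}\\v_{ij}^T&u_{ij}\end{pmatrix}\succeq0,$$ $$E^{ij}+\sum\lambda_lC_l^{ij}\preceq0,\quad\theta_{ij}+\sum\lambda_le_l^{ij}=0,\quad1-x_i-x_j+u_{ij}+\sum\lambda_l\xi_l^{ij}=0,\quad\begin{pmatrix}E^{ij}&\theta_{ij}\\\theta_{ij}^T&1-x_i-x_j+u_{ij}\end{pmatrix}\succeq0.$$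 For all $i,j$: $$R^{ij}+\sum\lambda_l\bar B_l^{ij}\preceq0,\quad U_i-v_{ij}+\sum\lambda_l\bar d_l^{ij}=0,\quad x_i-u_{ij}+\sum\lambda_l\bar\nu_l^{ij}=0,\quad\begin{pmatrix}R^{ij}&U_i-v_{ij}\\(U_i-v_{ij})^T&x_i-u_{ij}\end{pmatrix}\succeq0.$$ For all $i$: $$Y^{i}+\sum\lambda_lA_l^{i}\preceq0,\quad U_i+\sum\lambda_lc_l^i=0,\quad x_i+\sum\lambda_l\mu_l^i=0,\quad\begin{pmatrix}Y^i&U_i\\U_i^T&x_i\end{pmatrix}\succeq0,$$ $$R^{i}+\sum\lambda_lB_l^{i}\preceq0,\quad x-U_i+\sum\lambda_ld_l^i=0,\quad1-x_i+\sum\lambda_l\nu_l^i=0,\quad\begin{pmatrix}R^i&x-U_i\\(x-U_i)^T&1-x_i\end{pmatrix}\succeq0.$$ Finally: $$Y^{n+1}+\sum\lambda_l\Xi_l\preceq0,\quad x+\sum\lambda_l\omega_l=0,\quad1+\sum\lambda_l\gamma_l=0,\quad\begin{pmatrix}Y^{n+1}&x\\x^T&1\end{pmatrix}\succeq0.$$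 -/

import Mathlib

open scoped Matrix

noncomputable section

namespace SLC

/-- The factors that multiply the convex quadratics in a decomposition of a quartic. -/
inductive Factor (n : ℕ) : Type
  /-- the factor `x_i * x_j`, for `i ≤ j` -/
  | xx (i j : Fin n) (h : i ≤ j) : Factor n
  /-- the factor `x_i * (1 - x_j)`, for all `i, j` -/
  | xy (i j : Fin n) : Factor n
  /-- the factor `(1 - x_i) * (1 - x_j)`, for `i ≤ j` -/
  | yy (i j : Fin n) (h : i ≤ j) : Factor n
  /-- the factor `x_i` -/
  | x (i : Fin n) : Factor n
  /-- the factor `1 - x_i` -/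
  | y (i : Fin n) : Factor n
  /-- the constant factor `1` -/
  | one : Factor n
  deriving DecidableEq, Fintype

/-- The value of a factor at a point. -/
def Factor.value {n : ℕ} (x : Fin n → ℝ) : Factor n → ℝ
  | .xx i j _ => x i * x j
  | .xy i j => x i * (1 - x j)
  | .yy i j _ => (1 - x i) * (1 - x j)
  | .x i => x i
  | .y i => 1 - x i
  | .one => 1

/-- The coefficients `Z`: for every factor `k` a quadratic `xᵀ P_k x + xᵀ r_k + w_k`.
In the usual notation, `P` consists of `P^{ij}, Q^{ij}, T^{ij}, P^i, Q^i, P'`,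
`r` of `r^{ij}, f^{ij}, h^{ij}, r^i, f^i, r'`, and `w` of `w^{ij}, g^{ij}, s^{ij}, w^i, g^i, w'`,
on the factors `xx, xy, yy, x, y, one` respectively. -/
structure Coeffs (n : ℕ) where
  P : Factor n → Matrix (Fin n) (Fin n) ℝ
  r : Factor n → Fin n → ℝ
  w : Factor n → ℝ

/-- `Z` is a valid decomposition of `p` as a sum of factors times convex quadratics. -/
def Coeffs.IsDecomposition {n : ℕ} (Z : Coeffs n) (p : MvPolynomial (Fin n) ℝ) : Prop :=
  (∀ x : Fin n → ℝ, MvPolynomial.eval x p =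
    ∑ k, k.value x * (x ⬝ᵥ Z.P k *ᵥ x + x ⬝ᵥ Z.r k + Z.w k)) ∧
  ∀ k, (Z.P k).PosSemidef

/-- The data of a finite system of linear equations on `Z`, indexed by `ι`: the `l`-th equation is
`∑ k, (⟨A l k, P k⟩ + ⟨c l k, r k⟩ + μ l k * w k) = q l`. -/
structure LinearSystem (n : ℕ) (ι : Type*) where
  A : ι → Factor n → Matrix (Fin n) (Fin n) ℝ
  c : ι → Factor n → Fin n → ℝ
  μ : ι → Factor n → ℝ
  q : ι → ℝ

/-- The set `𝒱`: all coefficients that satisfy the linear equations and the LMIs `P k ⪰ 0`. -/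
def LinearSystem.feasibleSet {n : ℕ} {ι : Type*} (D : LinearSystem n ι) : Set (Coeffs n) :=
  {Z | (∀ l, ∑ k, ((D.A l k * (Z.P k)ᵀ).trace + D.c l k ⬝ᵥ Z.r k + D.μ l k * Z.w k) = D.q l) ∧
    ∀ k, (Z.P k).PosSemidef}

/-- The variables `(x, U, V)`, where `U` linearizes `x xᵀ` and `V i j` (that is, `v_{ij}`)
linearizes `u_{ij} x`. -/
structure LiftedPoint (n : ℕ) where
  x : Fin n → ℝ
  U : Matrix (Fin n) (Fin n) ℝ
  V : Fin n → Fin n → Fin n → ℝ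

/-- The linearization of a factor. -/
def LiftedPoint.lin {n : ℕ} (ξ : LiftedPoint n) : Factor n → ℝ
  | .xx i j _ => ξ.U i j
  | .xy i j => ξ.x i - ξ.U i j
  | .yy i j _ => 1 - ξ.x i - ξ.x j + ξ.U i j
  | .x i => ξ.x i
  | .y i => 1 - ξ.x i
  | .one => 1

/-- The linearization of a factor times the vector `x`; here `U.col i` is the `i`-th column. -/
def LiftedPoint.vec {n : ℕ} (ξ : LiftedPoint n) : Factor n → Fin n → ℝ
  | .xx i j _ => ξ.V i j
  | .xy i j => ξ.U.col i - ξ.V i j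
  | .yy i j _ => ξ.x - ξ.U.col i - ξ.U.col j + ξ.V i j
  | .x i => ξ.U.col i
  | .y i => ξ.x - ξ.U.col i
  | .one => ξ.x

/-- The (closed) perspective `(1/t) vᵀ P v` of the quadratic form of a positive semidefinite `P`,
with its usual values for `t ≤ 0`: at `t = 0` it is `0` if `vᵀ P v = 0` and `+∞` otherwise, and it
is `+∞` for `t < 0`. -/
def perspective {n : ℕ} (P : Matrix (Fin n) (Fin n) ℝ) (v : Fin n → ℝ) (t : ℝ) : EReal :=
  if 0 < t then ((1 / t * (v ⬝ᵥ P *ᵥ v) : ℝ) : EReal)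
  else if t = 0 ∧ v ⬝ᵥ P *ᵥ v = 0 then 0 else ⊤

/-- The relaxed objective `g₄(x, U, V, Z)`. -/
def g₄ {n : ℕ} (ξ : LiftedPoint n) (Z : Coeffs n) : EReal :=
  ∑ k, (perspective (Z.P k) (ξ.vec k) (ξ.lin k) +
    ((ξ.vec k ⬝ᵥ Z.r k + ξ.lin k * Z.w k : ℝ) : EReal))

/-- The objective of the outer problem: the worst case of `g₄` over the feasible coefficients. -/
def worstCase {n : ℕ} {ι : Type*} (D : LinearSystem n ι) (ξ : LiftedPoint n) : EReal :=
  ⨆ Z ∈ D.feasibleSet, g₄ ξ Z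

/-- `ξ` is an optimal solution of `min_{ξ ∈ X} max_{Z ∈ 𝒱} g₄(ξ, Z)`. As usual for extended-valued
objectives, a point with objective value `+∞` does not count as feasible. -/
def IsMinMaxOptimal {n : ℕ} {ι : Type*} (D : LinearSystem n ι) (X : Set (LiftedPoint n))
    (ξ : LiftedPoint n) : Prop :=
  ξ ∈ X ∧ worstCase D ξ < ⊤ ∧ ∀ η ∈ X, worstCase D ξ ≤ worstCase D η

/-- The bordered matrix `(Y, v; vᵀ, t)`. -/
def bordered {n : ℕ} (Y : Matrix (Fin n) (Fin n) ℝ) (v : Fin n → ℝ) (t : ℝ) :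
    Matrix (Fin n ⊕ Unit) (Fin n ⊕ Unit) ℝ :=
  Matrix.fromBlocks Y (Matrix.replicateCol Unit v) (Matrix.replicateRow Unit v)
    (Matrix.of fun _ _ => t)

/-- The feasible points of the SDP. The matrix variables `S` consist of
`Y^{ij}, R^{ij}, E^{ij}, Y^i, R^i, Y^{n+1}` on the factors `xx, xy, yy, x, y, one` respectively;
`M ⪯ 0` is written `(-M).PosSemidef`. -/
structure IsSDPFeasible {n : ℕ} {ι : Type*} [Fintype ι] (D : LinearSystem n ι)
    (X : Set (LiftedPoint n)) (ξ : LiftedPoint n)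
    (S : Factor n → Matrix (Fin n) (Fin n) ℝ) (lam : ι → ℝ) : Prop where
  matrix_le : ∀ k, (-(S k + ∑ l, lam l • D.A l k)).PosSemidef
  vec_eq : ∀ k, ξ.vec k + ∑ l, lam l • D.c l k = 0
  lin_eq : ∀ k, ξ.lin k + ∑ l, lam l * D.μ l k = 0
  lmi : ∀ k, (bordered (S k) (ξ.vec k) (ξ.lin k)).PosSemidef
  mem : ξ ∈ X

/-- The optimal solutions of the SDP, whose objective `-∑ l, λ_l q_l` is minimized. -/
def IsSDPOptimal {n : ℕ} {ι : Type*} [Fintype ι] (D : LinearSystem n ι)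
    (X : Set (LiftedPoint n)) (ξ : LiftedPoint n)
    (S : Factor n → Matrix (Fin n) (Fin n) ℝ) (lam : ι → ℝ) : Prop :=
  IsSDPFeasible D X ξ S lam ∧
    ∀ (ξ' : LiftedPoint n) (S' : Factor n → Matrix (Fin n) (Fin n) ℝ) (lam' : ι → ℝ),
      IsSDPFeasible D X ξ' S' lam' → -∑ l, lam l * D.q l ≤ -∑ l, lam' l * D.q l

/-! The system of equations that matches the coefficients of `p`, written out. It is an instance
of the systems above whose feasible set is the set of valid decompositions of `p`. -/

open MvPolynomial

/-- A factor as a polynomial. -/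
def Factor.poly {n : ℕ} : Factor n → MvPolynomial (Fin n) ℝ
  | .xx i j _ => X i * X j
  | .xy i j => X i * (1 - X j)
  | .yy i j _ => (1 - X i) * (1 - X j)
  | .x i => X i
  | .y i => 1 - X i
  | .one => 1

/-- The exponents of the monomials of degree at most `4`. -/
def exponents (n : ℕ) : Finset (Fin n →₀ ℕ) :=
  (Finset.range 5).biUnion fun d => Finset.finsuppAntidiag Finset.univ d

/-- The equations that match the coefficients of the monomials of degree at most `4`. -/
def coefficientMatching {n : ℕ} (p : MvPolynomial (Fin n) ℝ) : LinearSystem n (exponents n) where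
  A l k := Matrix.of fun a b => coeff l.1 (k.poly * (X a * X b))
  c l k a := coeff l.1 (k.poly * X a)
  μ l k := coeff l.1 k.poly
  q l := coeff l.1 p

/-- The polynomial that is the sum of the factors times the quadratics. -/
def Coeffs.poly {n : ℕ} (Z : Coeffs n) : MvPolynomial (Fin n) ℝ :=
  ∑ k : Factor n, ((∑ a, ∑ b, Z.P k a b • (k.poly * (X a * X b))) +
    (∑ a, Z.r k a • (k.poly * X a)) + Z.w k • k.poly)

theorem mem_exponents {n : ℕ} {s : Fin n →₀ ℕ} : s ∈ exponents n ↔ s.degree ≤ 4 := by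
  simp only [exponents, Finset.mem_biUnion, Finset.mem_range, Finset.mem_finsuppAntidiag,
    Finset.subset_univ, and_true, exists_eq_right', Finsupp.degree_eq_sum]
  exact Nat.lt_succ_iff

theorem Factor.poly_totalDegree {n : ℕ} (k : Factor n) : k.poly.totalDegree ≤ 2 := by
  have h1 : ∀ i : Fin n, (X i : MvPolynomial (Fin n) ℝ).totalDegree ≤ 1 := by simp
  have h2 : ∀ i : Fin n, (1 - X i : MvPolynomial (Fin n) ℝ).totalDegree ≤ 1 := fun i =>
    (totalDegree_sub _ _).trans (by simp)
  cases k with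
  | xx i j h => exact (totalDegree_mul _ _).trans (add_le_add (h1 i) (h1 j))
  | xy i j => exact (totalDegree_mul _ _).trans (add_le_add (h1 i) (h2 j))
  | yy i j h => exact (totalDegree_mul _ _).trans (add_le_add (h2 i) (h2 j))
  | x i => exact (h1 i).trans (by norm_num)
  | y i => exact (h2 i).trans (by norm_num)
  | one => simp [Factor.poly]

theorem Coeffs.poly_totalDegree {n : ℕ} (Z : Coeffs n) : Z.poly.totalDegree ≤ 4 := by
  have h1 : ∀ i : Fin n, (X i : MvPolynomial (Fin n) ℝ).totalDegree ≤ 1 := by simp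
  have h2 : ∀ i j : Fin n, (X i * X j : MvPolynomial (Fin n) ℝ).totalDegree ≤ 2 := fun i j =>
    (totalDegree_mul _ _).trans (add_le_add (h1 i) (h1 j))
  refine totalDegree_finsetSum_le fun k _ => ?_
  refine (totalDegree_add _ _).trans (max_le ((totalDegree_add _ _).trans (max_le ?_ ?_)) ?_)
  · refine totalDegree_finsetSum_le fun a _ => totalDegree_finsetSum_le fun b _ => ?_
    exact (totalDegree_smul_le _ _).trans
      ((totalDegree_mul _ _).trans (add_le_add k.poly_totalDegree (h2 a b)))
  · refine totalDegree_finsetSum_le fun a _ => ?_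
    exact (totalDegree_smul_le _ _).trans
      ((totalDegree_mul _ _).trans ((add_le_add k.poly_totalDegree (h1 a)).trans (by norm_num)))
  · exact (totalDegree_smul_le _ _).trans (k.poly_totalDegree.trans (by norm_num))

theorem Coeffs.eval_poly {n : ℕ} (Z : Coeffs n) (x : Fin n → ℝ) : eval x Z.poly =
    ∑ k : Factor n, k.value x * (x ⬝ᵥ Z.P k *ᵥ x + x ⬝ᵥ Z.r k + Z.w k) := by
  have hk : ∀ k : Factor n, eval x k.poly = k.value x := by
    intro k; cases k <;> simp [Factor.poly, Factor.value]
  simp only [Coeffs.poly, map_sum, map_add, smul_eval, map_mul, hk, eval_X]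
  refine Finset.sum_congr rfl fun k _ => ?_
  simp only [dotProduct, Matrix.mulVec, mul_add, Finset.mul_sum]
  congr 1
  · congr 1
    · refine Finset.sum_congr rfl fun a _ => Finset.sum_congr rfl fun b _ => by ring
    · refine Finset.sum_congr rfl fun a _ => by ring
  · ring

theorem mem_feasibleSet_coefficientMatching {n : ℕ} (p : MvPolynomial (Fin n) ℝ)
    (hp : p.totalDegree ≤ 4) (Z : Coeffs n) :
    Z ∈ (coefficientMatching p).feasibleSet ↔ Z.IsDecomposition p := by
  have hc : ∀ l : exponents n, coeff l.1 Z.poly =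
      ∑ k, (((coefficientMatching p).A l k * (Z.P k)ᵀ).trace +
        (coefficientMatching p).c l k ⬝ᵥ Z.r k + (coefficientMatching p).μ l k * Z.w k) := by
    intro l
    simp only [Coeffs.poly, coeff_sum, coeff_add, coeff_smul, coefficientMatching, Matrix.trace,
      Matrix.diag, Matrix.mul_apply, dotProduct, Matrix.of_apply, Matrix.transpose_apply,
      smul_eq_mul, mul_comm]
  have hd : ∀ r : MvPolynomial (Fin n) ℝ, r.totalDegree ≤ 4 → ∀ s, s ∉ exponents n →
      coeff s r = 0 := by
    intro r hr s hs
    refine coeff_eq_zero_of_totalDegree_lt ?_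
    rw [mem_exponents, Finsupp.degree_apply] at hs
    omega
  refine and_congr ?_ Iff.rfl
  simp only [← Coeffs.eval_poly, ← hc]
  rw [← MvPolynomial.funext_iff, MvPolynomial.ext_iff]
  refine ⟨fun h s => ?_, fun h l => (h l.1).symm⟩
  by_cases hs : s ∈ exponents n
  · exact (h ⟨s, hs⟩).symm
  · rw [hd p hp s hs, hd _ Z.poly_totalDegree s hs]

theorem isSymm_coefficientMatching {n : ℕ} (p : MvPolynomial (Fin n) ℝ) (l : exponents n)
    (k : Factor n) : ((coefficientMatching p).A l k).IsSymm := by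
  ext a b
  simp [coefficientMatching, mul_comm (X a)]

end SLC

end

/-! Fix `(x, U, V)`, and write `v`, `t` for the linearizations `ξ.vec k`, `ξ.lin k`. If every `t ≥
0`, and `v = 0` whenever `t = 0`, then `(1/t) vᵀPv = ⟨(1/t) vvᵀ, P⟩` is linear in `P`, so the inner
maximum is a linear conic program in `Z`. The SDP is its dual, with `λ` the multipliers of the
equations; by Schur complements the bordered LMI says that `S k` dominates `(1/t) vvᵀ`. Weak duality
(`IsSDPFeasible.worstCase_le`) bounds the worst case by each SDP value at the same point. Strong
duality with attainment (`exists_isSDPFeasible_le_worstCase`) gives the converse wherever the worst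
case is finite. Hence the optimal points agree.

Attainment rests on a Slater point: a decomposition with every `P k ⪰ 1`
(`exists_isDecomposition_sub_one`). Since `x_i` and `1 - x_i` sum to `1`, even `-k(x) (aᵀx)²` is
representable. So `p - ∑ k(x) xᵀx` is decomposable, and adding the identity to every matrix restores
`p`. The Slater point also forces the above conditions on `t` and `v` when the worst case is finite,
and it is the order unit in the duality theorem `exists_dual_of_forall_le`. -/

namespace SLC

/-! ### Strictly convex decompositions of quartics -/

/-- A function is representable if it is a sum of factors times convex quadratics. -/
def Representable {n : ℕ} (g : (Fin n → ℝ) → ℝ) : Prop :=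
  ∃ Z : Coeffs n, (∀ k, (Z.P k).PosSemidef) ∧
    ∀ x, g x = ∑ k, k.value x * (x ⬝ᵥ Z.P k *ᵥ x + x ⬝ᵥ Z.r k + Z.w k)

namespace Representable

variable {n : ℕ} {g h : (Fin n → ℝ) → ℝ}

theorem add (hg : Representable g) (hh : Representable h) :
    Representable fun x => g x + h x := by
  obtain ⟨Z, hZ, hZg⟩ := hg
  obtain ⟨W, hW, hWh⟩ := hh
  refine ⟨⟨Z.P + W.P, Z.r + W.r, Z.w + W.w⟩, fun k => (hZ k).add (hW k), fun x => ?_⟩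
  beta_reduce
  rw [hZg, hWh, ← Finset.sum_add_distrib]
  refine Finset.sum_congr rfl fun k _ => ?_
  simp only [Pi.add_apply, Matrix.add_mulVec, dotProduct_add]
  ring

theorem zero : Representable fun _ : Fin n → ℝ => 0 :=
  ⟨⟨0, 0, 0⟩, fun _ => .zero, fun x => by simp⟩

theorem smul (hg : Representable g) {c : ℝ} (hc : 0 ≤ c) : Representable fun x => c * g x := by
  obtain ⟨Z, hZ, hZg⟩ := hg
  refine ⟨⟨c • Z.P, c • Z.r, c • Z.w⟩, fun k => (hZ k).smul hc, fun x => ?_⟩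
  beta_reduce
  rw [hZg, Finset.mul_sum]
  refine Finset.sum_congr rfl fun k _ => ?_
  simp only [Pi.smul_apply, Matrix.smul_mulVec, dotProduct_smul, smul_eq_mul]
  ring

theorem sum {α : Type*} (s : Finset α) {f : α → (Fin n → ℝ) → ℝ}
    (hf : ∀ a ∈ s, Representable (f a)) : Representable fun x => ∑ a ∈ s, f a x := by
  classical
  induction s using Finset.induction_on with
  | empty => simpa using zero
  | insert a s ha ih =>
    simp only [Finset.sum_insert ha]
    exact (hf a (by simp)).add (ih fun b hb => hf b (by simp [hb]))

theorem factor_mul (k : Factor n) {P : Matrix (Fin n) (Fin n) ℝ} (hP : P.PosSemidef)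
    (r : Fin n → ℝ) (w : ℝ) :
    Representable fun x => k.value x * (x ⬝ᵥ P *ᵥ x + x ⬝ᵥ r + w) := by
  refine ⟨⟨Pi.single k P, Pi.single k r, Pi.single k w⟩, fun l => ?_, fun x => ?_⟩
  · by_cases h : l = k
    · subst h; simpa using hP
    · simpa [h] using Matrix.PosSemidef.zero
  · rw [Finset.sum_eq_single k]
    · simp
    · intro l _ h
      simp [h]
    · simp

theorem factor_mul_affine (k : Factor n) (r : Fin n → ℝ) (w : ℝ) :
    Representable fun x => k.value x * (x ⬝ᵥ r + w) := by
  simpa using factor_mul k .zero r w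

theorem factor_mul_sq (k : Factor n) (a : Fin n → ℝ) :
    Representable fun x => k.value x * (a ⬝ᵥ x) ^ 2 := by
  convert! factor_mul k (Matrix.posSemidef_vecMulVec_self_star a) 0 0 using 3 with x
  simp only [Matrix.vecMulVec_mulVec, star_trivial, dotProduct_zero, add_zero]
  simp [dotProduct_smul, dotProduct_comm x a, sq]

/-- Expanding one of the two linear forms gives `∑ x_b (-a_b aᵀx)`: factors times linear functions,
whose sign is unrestricted. -/
theorem neg_sq (a : Fin n → ℝ) : Representable fun x => -(a ⬝ᵥ x) ^ 2 := by
  convert! sum Finset.univ fun b _ => factor_mul_affine (.x b) (-a b • a) 0 using 2 with x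
  simp only [Factor.value, dotProduct_smul, dotProduct_comm x a, smul_eq_mul, add_zero]
  calc -(a ⬝ᵥ x) ^ 2 = -((∑ i, a i * x i) * (a ⬝ᵥ x)) := by rw [sq]; rfl
    _ = _ := by
      rw [Finset.sum_mul, ← Finset.sum_neg_distrib]
      exact Finset.sum_congr rfl fun i _ => by ring

/-- Replacing one linear term of the factor by its complement flips the sign, up to a factor of
lower degree: `-x_i q² = (1 - x_i) q² - q²`. -/
theorem neg_factor_mul_sq (k : Factor n) (a : Fin n → ℝ) :
    Representable fun x => -(k.value x * (a ⬝ᵥ x) ^ 2) := by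
  have hx (i : Fin n) : Representable fun x => -(x i * (a ⬝ᵥ x) ^ 2) := by
    convert! (factor_mul_sq (.y i) a).add (neg_sq a) using 2 with x
    simp only [Factor.value]; ring
  have hy (i : Fin n) : Representable fun x => -((1 - x i) * (a ⬝ᵥ x) ^ 2) := by
    convert! (factor_mul_sq (.x i) a).add (neg_sq a) using 2 with x
    simp only [Factor.value]; ring
  cases k with
  | xx i j h =>
    convert! (factor_mul_sq (.xy i j) a).add (hx i) using 2 with x
    simp only [Factor.value]; ring
  | xy i j =>
    rcases le_total i j with h | h
    · convert! (factor_mul_sq (.xx i j h) a).add (hx i) using 2 with x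
      simp only [Factor.value]; ring
    · convert! (factor_mul_sq (.xx j i h) a).add (hx i) using 2 with x
      simp only [Factor.value]; ring
  | yy i j h =>
    convert! (factor_mul_sq (.xy i j) a).add (hy j) using 2 with x
    simp only [Factor.value]; ring
  | x i => exact hx i
  | y i => exact hy i
  | one => simpa [Factor.value] using neg_sq a

/-- Polarization: `4 x_a x_b = (x_a + x_b)² - (x_a - x_b)²`, where both signs of a square are
available. -/
theorem factor_mul_mul (k : Factor n) (a b : Fin n) (c : ℝ) :
    Representable fun x => c * (k.value x * (x a * x b)) := by
  have hp : Representable fun x => k.value x * (x a * x b) := by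
    convert! ((factor_mul_sq k (Pi.single a 1 + Pi.single b 1)).add
      (neg_factor_mul_sq k (Pi.single a 1 - Pi.single b 1))).smul (c := 1 / 4) (by norm_num)
      using 2 with x
    simp only [add_dotProduct, sub_dotProduct, single_dotProduct, one_mul]; ring
  have hm : Representable fun x => -(k.value x * (x a * x b)) := by
    convert! ((neg_factor_mul_sq k (Pi.single a 1 + Pi.single b 1)).add
      (factor_mul_sq k (Pi.single a 1 - Pi.single b 1))).smul (c := 1 / 4) (by norm_num)
      using 2 with x
    simp only [add_dotProduct, sub_dotProduct, single_dotProduct, one_mul]; ring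
  rcases le_total 0 c with hc | hc
  · exact hp.smul hc
  · simpa using hm.smul (neg_nonneg.2 hc)

theorem list_prod (l : List (Fin n)) (hl : l.length ≤ 4) (c : ℝ) :
    Representable fun x => c * (l.map x).prod := by
  match l, hl with
  | [], _ => simpa [Factor.value] using factor_mul_affine (.one : Factor n) 0 c
  | [a], _ =>
    convert! factor_mul_affine (.x a) 0 c using 2 with x
    simp [Factor.value, mul_comm]
  | [a, b], _ =>
    convert! factor_mul_mul .one a b c using 2 with x
    simp [Factor.value]
  | [a, b, d], _ =>
    convert! factor_mul_mul (.x a) b d c using 2 with x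
    simp [Factor.value]
  | [a, b, d, e], _ =>
    rcases le_total a b with h | h
    · convert! factor_mul_mul (.xx a b h) d e c using 2 with x
      simp [Factor.value, mul_assoc]
    · convert! factor_mul_mul (.xx b a h) d e c using 2 with x
      simp only [List.map_cons, List.prod_cons, List.map_nil, List.prod_nil, Factor.value]
      ring
  | a :: b :: d :: e :: f :: l, h => simp at h; omega

/-- Every polynomial of degree at most four is a sum of factors times convex quadratics. -/
theorem eval (p : MvPolynomial (Fin n) ℝ) (hp : p.totalDegree ≤ 4) :
    Representable fun x => MvPolynomial.eval x p := by
  simp only [MvPolynomial.eval_eq]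
  refine sum _ fun d hd => ?_
  obtain ⟨l, hl⟩ := Quot.exists_rep (Finsupp.toMultiset d)
  replace hl : (l : Multiset (Fin n)) = Finsupp.toMultiset d := hl
  have hlen : l.length ≤ 4 := by
    rw [← Multiset.coe_card, hl, Finsupp.card_toMultiset]
    exact (MvPolynomial.le_totalDegree hd).trans hp
  convert! list_prod l hlen (p.coeff d) using 3 with x
  rw [← Multiset.prod_coe, ← Multiset.map_coe, hl, Finsupp.toMultiset_map, Finsupp.prod_toMultiset,
    Finsupp.prod_mapDomain_index (by simp) (by simp [pow_add])]
  rfl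

end Representable

/-- Every polynomial of degree at most four has a decomposition into factors times strictly convex
quadratics. -/
theorem exists_isDecomposition_sub_one {n : ℕ} (p : MvPolynomial (Fin n) ℝ)
    (hp : p.totalDegree ≤ 4) :
    ∃ Z : Coeffs n, Z.IsDecomposition p ∧ ∀ k, (Z.P k - 1).PosSemidef := by
  -- Subtracting `k(x) xᵀx` for every factor leaves room to add the identity to every matrix.
  have h : Representable fun x : Fin n → ℝ =>
      MvPolynomial.eval x p + ∑ k : Factor n, ∑ a, -1 * (k.value x * (x a * x a)) :=
    (Representable.eval p hp).add <| .sum _ fun k _ => .sum _ fun a _ => .factor_mul_mul k a a _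
  obtain ⟨Z, hZ, hZp⟩ := h
  refine ⟨⟨fun k => Z.P k + 1, Z.r, Z.w⟩, ⟨fun x => ?_, fun k => (hZ k).add .one⟩,
    fun k => by simpa using hZ k⟩
  rw [← sub_eq_iff_eq_add.2 (hZp x).symm, sub_eq_add_neg, ← Finset.sum_neg_distrib,
    ← Finset.sum_add_distrib]
  refine Finset.sum_congr rfl fun k _ => ?_
  simp only [← Finset.mul_sum, Matrix.add_mulVec, Matrix.one_mulVec, dotProduct_add]
  change _ + -(-1 * (_ * (x ⬝ᵥ x))) = _
  ring


/-! ### Conic duality -/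

/-- Conic duality with attainment of the dual optimum, for a cone with an order unit `z₀` that is
feasible for the primal problem. -/
theorem exists_dual_of_forall_le {E ι : Type*} [AddCommGroup E] [Module ℝ E] [Fintype ι]
    (K : PointedCone ℝ E) (M : ι → E →ₗ[ℝ] ℝ) (q : ι → ℝ) (L : E →ₗ[ℝ] ℝ) (s : ℝ) (z₀ : E)
    (hz₀ : z₀ ∈ K) (hM : ∀ l, M l z₀ = q l) (hunit : ∀ y, ∃ c : ℝ, c • z₀ + y ∈ K)
    (hs : ∀ z ∈ K, (∀ l, M l z = q l) → L z ≤ s) :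
    ∃ lam : ι → ℝ, ∑ l, lam l * q l ≤ s ∧ ∀ z ∈ K, L z ≤ ∑ l, lam l * M l z := by
  have hsmul {c : ℝ} (hc : 0 ≤ c) {z : E} (hz : z ∈ K) : c • z ∈ K := K.smul_mem hc hz
  -- Homogenization: on the subspace `M z = τ q`, the functional `s τ - L z` is nonnegative on `K ×
  -- ℝ≥0`. The M. Riesz theorem extends it to a functional nonnegative on the whole cone.
  let T : ι → E × ℝ →ₗ[ℝ] ℝ := fun l => (M l).comp (.fst ℝ E ℝ) - q l • .snd ℝ E ℝ
  let f : E × ℝ →ₗ[ℝ] ℝ := s • .snd ℝ E ℝ - L.comp (.fst ℝ E ℝ)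
  let p : Submodule ℝ (E × ℝ) := ⨅ l, LinearMap.ker (T l)
  have hp {z : E} {τ : ℝ} : (z, τ) ∈ p ↔ ∀ l, M l z = q l * τ := by
    simp [p, T, Submodule.mem_iInf, sub_eq_zero]
  obtain ⟨g, hgf, hg⟩ := riesz_extension (Submodule.prod K (PointedCone.positive ℝ ℝ))
    ⟨p, f.domRestrict p⟩ (by
      rintro ⟨⟨z, τ⟩, hz⟩ ⟨hzK, hτ⟩
      have hz' := hp.1 hz
      replace hτ : 0 ≤ τ := by simpa using hτ
      change 0 ≤ s * τ - L z
      -- For `τ = 0`, `z` is a recession direction: if `L z > 0`, the multiple of `z` chosen below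
      -- moves `z₀` to value `s + 1`.
      rcases hτ.eq_or_lt with rfl | hτ
      · by_contra! hlt
        have hL : 0 < L z := by linarith
        have h0 := hs z₀ hz₀ hM
        have h1 := hs (z₀ + ((s - L z₀ + 1) / L z) • z)
          (K.add_mem hz₀ (hsmul (div_nonneg (by linarith) hL.le) hzK)) fun l => by
            simp [hM, hz']
        rw [map_add, map_smul, smul_eq_mul, div_mul_cancel₀ _ hL.ne'] at h1
        linarith
      · have h1 := hs (τ⁻¹ • z) (hsmul (inv_nonneg.2 hτ.le) hzK) fun l => by
          simp [hz']; field_simp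
        rw [map_smul, smul_eq_mul, inv_mul_le_iff₀ hτ] at h1
        linarith) (by
      rintro ⟨z, τ⟩
      obtain ⟨c, hc⟩ := hunit z
      refine ⟨⟨(max c |τ| • z₀, max c |τ|), hp.2 fun l => by simp [hM, mul_comm]⟩, ?_, ?_⟩
      · have h : max c |τ| • z₀ + z = (c • z₀ + z) + (max c |τ| - c) • z₀ := by module
        change max c |τ| • z₀ + z ∈ K
        rw [h]
        exact K.add_mem hc (hsmul (sub_nonneg.2 (le_max_left _ _)) hz₀)
      · change 0 ≤ max c |τ| + τ
        linarith [le_max_right c |τ|, neg_abs_le τ])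
  -- The extension differs from `f` by a functional vanishing on the common kernel of the `T l`; its
  -- coefficients are the multipliers.
  have hspan : g - f ∈ Submodule.span ℝ (Set.range T) :=
    mem_span_of_iInf_ker_le_ker fun x hx => by
      simpa [sub_eq_zero] using hgf ⟨x, hx⟩
  obtain ⟨lam, hlam⟩ := (Submodule.mem_span_range_iff_exists_fun ℝ).1 hspan
  have hlam' (z : E) (τ : ℝ) : g (z, τ) = s * τ - L z + ∑ l, lam l * (M l z - q l * τ) := by
    have := LinearMap.congr_fun hlam (z, τ)
    simp only [LinearMap.sum_apply, LinearMap.smul_apply, LinearMap.sub_apply, T, f,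
      LinearMap.comp_apply, LinearMap.fst_apply, LinearMap.snd_apply, smul_eq_mul] at this
    linarith
  refine ⟨lam, ?_, fun z hz => ?_⟩
  · have h := hg (0, 1) ⟨K.zero_mem, by simp⟩
    simp only [hlam', map_zero, mul_one, zero_sub, mul_neg, Finset.sum_neg_distrib] at h
    linarith
  · have h := hg (z, 0) ⟨hz, by simp⟩
    simp only [hlam', mul_zero, sub_zero] at h
    linarith

/-! ### Semidefinite matrices and perspectives -/

variable {n : ℕ}

theorem trace_mul_vecMulVec (A : Matrix (Fin n) (Fin n) ℝ) (a : Fin n → ℝ) :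
    (A * (Matrix.vecMulVec a a)ᵀ).trace = a ⬝ᵥ A *ᵥ a := by
  rw [Matrix.transpose_vecMulVec, Matrix.mul_vecMulVec, Matrix.trace_vecMulVec, dotProduct_comm]

theorem exists_eq_sum_sq {P : Matrix (Fin n) (Fin n) ℝ} (hP : P.PosSemidef) :
    ∃ (m : ℕ) (a : Fin m → Fin n → ℝ),
      (∀ A : Matrix (Fin n) (Fin n) ℝ, (A * Pᵀ).trace = ∑ i, a i ⬝ᵥ A *ᵥ a i) ∧
      ∀ v, v ⬝ᵥ P *ᵥ v = ∑ i, (a i ⬝ᵥ v) ^ 2 := by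
  obtain ⟨m, a, rfl⟩ := Matrix.posSemidef_iff_eq_sum_vecMulVec.1 hP
  refine ⟨m, a, fun A => ?_, fun v => ?_⟩
  · simp only [star_trivial, Matrix.transpose_sum, Matrix.mul_sum, Matrix.trace_sum,
      trace_mul_vecMulVec]
  · simp only [star_trivial, Matrix.sum_mulVec, dotProduct_sum, Matrix.vecMulVec_mulVec]
    refine Finset.sum_congr rfl fun i _ => ?_
    simp [dotProduct_comm v, sq]

theorem dotProduct_mulVec_nonneg {A : Matrix (Fin n) (Fin n) ℝ} (hA : A.PosSemidef)
    (a : Fin n → ℝ) : 0 ≤ a ⬝ᵥ A *ᵥ a := by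
  simpa using hA.dotProduct_mulVec_nonneg a

theorem trace_mul_transpose_nonneg {A P : Matrix (Fin n) (Fin n) ℝ} (hA : A.PosSemidef)
    (hP : P.PosSemidef) : 0 ≤ (A * Pᵀ).trace := by
  obtain ⟨m, a, h, -⟩ := exists_eq_sum_sq hP
  rw [h]
  exact Finset.sum_nonneg fun i _ => dotProduct_mulVec_nonneg hA _

theorem bordered_form_nonneg {S : Matrix (Fin n) (Fin n) ℝ} {v : Fin n → ℝ} {t : ℝ}
    (h : (bordered S v t).PosSemidef) (b : Fin n → ℝ) (s : ℝ) :
    0 ≤ b ⬝ᵥ S *ᵥ b + 2 * s * (b ⬝ᵥ v) + s ^ 2 * t := by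
  have h1 := h.dotProduct_mulVec_nonneg (Sum.elim b fun _ => s)
  have hr : Matrix.replicateCol Unit v *ᵥ (fun _ => s) = s • v := by
    ext; simp [Matrix.mulVec, dotProduct, mul_comm]
  have hc : Matrix.replicateRow Unit v *ᵥ b = fun _ => b ⬝ᵥ v := by
    ext; simp [Matrix.mulVec, dotProduct, mul_comm]
  rw [star_trivial, bordered, Matrix.fromBlocks_mulVec, Sum.elim_comp_inl, Sum.elim_comp_inr,
    hr, hc, sumElim_dotProduct_sumElim] at h1
  have hu : (fun _ : Unit => s) ⬝ᵥ ((fun _ => b ⬝ᵥ v) +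
      Matrix.of (fun _ _ : Unit => t) *ᵥ fun _ => s) =
      s * (b ⬝ᵥ v + t * s) := by
    simp [dotProduct, Matrix.mulVec]
  rw [hu, dotProduct_add, dotProduct_smul, smul_eq_mul] at h1
  linarith

theorem posSemidef_bordered {v : Fin n → ℝ} {t : ℝ} (ht : 0 ≤ t) (hv : t = 0 → v = 0) :
    (bordered ((1 / t) • Matrix.vecMulVec v v) v t).PosSemidef := by
  have h : bordered ((1 / t) • Matrix.vecMulVec v v) v t =
      (1 / t) • Matrix.vecMulVec (Sum.elim v fun _ => t) (star (Sum.elim v fun _ => t)) := by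
    -- At `t = 0` both sides vanish, as `1 / 0 = 0` and `v = 0`.
    rcases eq_or_ne t 0 with rfl | h0
    · ext (i | i) (j | j) <;> simp [bordered, hv rfl]
    · ext (i | i) (j | j) <;> simp [bordered, Matrix.vecMulVec_apply] <;> field_simp
  rw [h]
  exact (Matrix.posSemidef_vecMulVec_self_star _).smul (by positivity)

/-- A Schur complement argument, carried out on each rank-one summand of `P`. -/
theorem perspective_le {S P : Matrix (Fin n) (Fin n) ℝ} {v : Fin n → ℝ} {t : ℝ}
    (hS : (bordered S v t).PosSemidef) (hP : P.PosSemidef) :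
    perspective P v t ≤ ((S * Pᵀ).trace : ℝ) := by
  obtain ⟨m, a, htr, hform⟩ := exists_eq_sum_sq hP
  have hb := bordered_form_nonneg hS
  have ht : 0 ≤ t := by simpa using hb 0 1
  have hS0 (b : Fin n → ℝ) : 0 ≤ b ⬝ᵥ S *ᵥ b := by simpa using hb b 0
  unfold perspective
  rw [htr, hform]
  split_ifs with h1 h2
  · rw [EReal.coe_le_coe_iff, Finset.mul_sum]
    refine Finset.sum_le_sum fun i _ => ?_
    -- The minimizer of the bordered form over its last coordinate.
    have := hb (a i) (-(a i ⬝ᵥ v) / t)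
    field_simp at this ⊢
    linarith
  · exact_mod_cast Finset.sum_nonneg fun i _ => hS0 _
  · obtain rfl : t = 0 := le_antisymm (not_lt.1 h1) ht
    refine absurd ⟨rfl, Finset.sum_eq_zero fun i _ => ?_⟩ h2
    by_contra hne
    have hne' : a i ⬝ᵥ v ≠ 0 := fun h => hne (by simp [h])
    -- At `t = 0` the form is affine in the last coordinate with nonzero slope; this choice gives it
    -- the value `-1`.
    have := hb (a i) (-(a i ⬝ᵥ S *ᵥ a i + 1) / (2 * (a i ⬝ᵥ v)))
    have he : 2 * (-(a i ⬝ᵥ S *ᵥ a i + 1) / (2 * (a i ⬝ᵥ v))) * (a i ⬝ᵥ v) =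
        -(a i ⬝ᵥ S *ᵥ a i + 1) := by
      field_simp
    rw [he] at this
    linarith

theorem coe_sum_ereal {α : Type*} (s : Finset α) (f : α → ℝ) :
    ((∑ a ∈ s, f a : ℝ) : EReal) = ∑ a ∈ s, (f a : EReal) := by
  classical
  induction s using Finset.induction_on with
  | empty => simp
  | insert a s ha ih => rw [Finset.sum_insert ha, Finset.sum_insert ha, EReal.coe_add, ih]

theorem sum_eq_top_ereal {α : Type*} {s : Finset α} {f : α → EReal} (hf : ∀ a ∈ s, f a ≠ ⊥)
    {a : α} (ha : a ∈ s) (h : f a = ⊤) : ∑ b ∈ s, f b = ⊤ := by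
  classical
  rw [← Finset.add_sum_erase s f ha, h, EReal.top_add_of_ne_bot]
  exact Finset.sum_induction f (· ≠ ⊥) (fun _ _ h1 h2 => EReal.add_ne_bot_iff.2 ⟨h1, h2⟩)
    EReal.zero_ne_bot fun b hb => hf b (Finset.mem_of_mem_erase hb)

theorem perspective_ne_bot (P : Matrix (Fin n) (Fin n) ℝ) (v : Fin n → ℝ) (t : ℝ) :
    perspective P v t ≠ ⊥ := by
  unfold perspective
  split_ifs
  exacts [EReal.coe_ne_bot _, EReal.zero_ne_bot, top_ne_bot]

theorem perspective_ne_top_of_g₄ {ξ : LiftedPoint n} {Z : Coeffs n} (h : g₄ ξ Z ≠ ⊤)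
    (k : Factor n) : perspective (Z.P k) (ξ.vec k) (ξ.lin k) ≠ ⊤ := fun hk =>
  h <| sum_eq_top_ereal
    (fun _ _ => EReal.add_ne_bot_iff.2 ⟨perspective_ne_bot _ _ _, EReal.coe_ne_bot _⟩)
    (Finset.mem_univ k) (by rw [hk, EReal.top_add_coe])

/-! ### Weak and strong duality for the inner problem -/

/-- The bilinear pairing of the data of an equation with the coefficients. -/
def pairing (A : Factor n → Matrix (Fin n) (Fin n) ℝ) (c : Factor n → Fin n → ℝ)
    (μ : Factor n → ℝ) :
    (Factor n → Matrix (Fin n) (Fin n) ℝ) × (Factor n → Fin n → ℝ) × (Factor n → ℝ) →ₗ[ℝ] ℝ where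
  toFun Z := ∑ k, ((A k * (Z.1 k)ᵀ).trace + c k ⬝ᵥ Z.2.1 k + μ k * Z.2.2 k)
  map_add' Y Z := by
    rw [← Finset.sum_add_distrib]
    refine Finset.sum_congr rfl fun k _ => ?_
    simp [Matrix.mul_add, dotProduct_add]
    ring
  map_smul' a Z := by
    rw [RingHom.id_apply, smul_eq_mul, Finset.mul_sum]
    refine Finset.sum_congr rfl fun k _ => ?_
    simp [dotProduct_smul]
    ring

variable {ι : Type*} {D : LinearSystem n ι} {X : Set (LiftedPoint n)} {ξ : LiftedPoint n}

/-- Weak duality: `perspective_le` linearizes the objective, the vector and scalar constraints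
cancel the `r` and `w` terms, and `matrix_le` handles the traces. -/
theorem IsSDPFeasible.worstCase_le [Fintype ι] {S : Factor n → Matrix (Fin n) (Fin n) ℝ}
    {lam : ι → ℝ} (h : IsSDPFeasible D X ξ S lam) :
    worstCase D ξ ≤ ((-∑ l, lam l * D.q l : ℝ) : EReal) := by
  refine iSup₂_le fun Z hZ => ?_
  have h1 : g₄ ξ Z ≤ ((∑ k, ((S k * (Z.P k)ᵀ).trace +
      (ξ.vec k ⬝ᵥ Z.r k + ξ.lin k * Z.w k)) : ℝ) : EReal) := by
    rw [coe_sum_ereal]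
    refine Finset.sum_le_sum fun k _ => ?_
    rw [EReal.coe_add]
    exact add_le_add_left (perspective_le (h.lmi k) (hZ.2 k)) _
  refine h1.trans (EReal.coe_le_coe_iff.2 ?_)
  simp only [← hZ.1, Finset.mul_sum]
  rw [Finset.sum_comm, ← Finset.sum_neg_distrib]
  refine Finset.sum_le_sum fun k _ => ?_
  have h2 := trace_mul_transpose_nonneg (h.matrix_le k) (hZ.2 k)
  have h3 : (ξ.vec k + ∑ l, lam l • D.c l k) ⬝ᵥ Z.r k = 0 := by rw [h.vec_eq, zero_dotProduct]
  have h4 : (ξ.lin k + ∑ l, lam l * D.μ l k) * Z.w k = 0 := by rw [h.lin_eq, zero_mul]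
  simp only [Matrix.neg_mul, Matrix.trace_neg, Matrix.add_mul, Matrix.trace_add, Matrix.sum_mul,
    Matrix.trace_sum, Matrix.smul_mul, Matrix.trace_smul, smul_eq_mul] at h2
  simp only [add_dotProduct, sum_dotProduct, smul_dotProduct, smul_eq_mul] at h3
  simp only [add_mul, Finset.sum_mul, mul_assoc] at h4
  simp only [mul_add, Finset.sum_add_distrib]
  linarith

/-- This is the order unit property: `P₀ k ⪰ 1`, and a form is bounded by the sum of its absolute
entries times `vᵀv`. Summing over all factors gives one constant for all. -/
theorem exists_smul_add_form_nonneg {P₀ : Factor n → Matrix (Fin n) (Fin n) ℝ}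
    (h₀ : ∀ k, (P₀ k - 1).PosSemidef) (P : Factor n → Matrix (Fin n) (Fin n) ℝ) :
    ∃ c : ℝ, ∀ k v, 0 ≤ v ⬝ᵥ (c • P₀ k + P k) *ᵥ v := by
  have hc (k : Factor n) : 0 ≤ ∑ a, ∑ b, |P k a b| := by positivity
  refine ⟨∑ k, ∑ a, ∑ b, |P k a b|, fun k v => ?_⟩
  have h1 : v ⬝ᵥ v ≤ v ⬝ᵥ P₀ k *ᵥ v := by
    have := dotProduct_mulVec_nonneg (h₀ k) v
    rw [Matrix.sub_mulVec, Matrix.one_mulVec, dotProduct_sub] at this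
    linarith
  have hvv : 0 ≤ v ⬝ᵥ v := by simpa using dotProduct_star_self_nonneg v
  have hsq (a : Fin n) : |v a| ^ 2 ≤ v ⬝ᵥ v := by
    rw [sq_abs, sq]
    exact Finset.single_le_sum (f := fun a => v a * v a) (fun _ _ => mul_self_nonneg _)
      (Finset.mem_univ a)
  have h2 : -((∑ a, ∑ b, |P k a b|) * (v ⬝ᵥ v)) ≤ v ⬝ᵥ P k *ᵥ v := by
    have hexp : v ⬝ᵥ P k *ᵥ v = ∑ a, ∑ b, v a * (P k a b * v b) := by
      simp only [Matrix.mulVec, dotProduct, Finset.mul_sum]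
    simp only [hexp, Finset.sum_mul, ← Finset.sum_neg_distrib]
    refine Finset.sum_le_sum fun a _ => Finset.sum_le_sum fun b _ => ?_
    have hab : |v a| * |v b| ≤ v ⬝ᵥ v := by
      nlinarith [hsq a, hsq b, sq_nonneg (|v a| - |v b|)]
    have h3 := neg_abs_le (v a * (P k a b * v b))
    rw [abs_mul, abs_mul, mul_left_comm] at h3
    exact (neg_le_neg (mul_le_mul_of_nonneg_left hab (abs_nonneg (P k a b)))).trans h3
  have h3 := Finset.single_le_sum (f := fun k => ∑ a, ∑ b, |P k a b|) (fun k _ => hc k)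
    (Finset.mem_univ k)
  rw [Matrix.add_mulVec, Matrix.smul_mulVec, dotProduct_add, dotProduct_smul, smul_eq_mul]
  have h4 := mul_le_mul_of_nonneg_left h1 ((hc k).trans h3)
  have h5 := mul_le_mul_of_nonneg_right h3 hvv
  linarith

/-- The cone of coefficients whose matrices, which need not be symmetric, have nonnegative
quadratic forms. -/
def formCone (n : ℕ) : PointedCone ℝ
    ((Factor n → Matrix (Fin n) (Fin n) ℝ) × (Factor n → Fin n → ℝ) × (Factor n → ℝ)) where
  carrier := {Z | ∀ k v, 0 ≤ v ⬝ᵥ Z.1 k *ᵥ v}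
  add_mem' {Y Z} hY hZ k v := by
    simpa [Matrix.add_mulVec, dotProduct_add] using add_nonneg (hY k v) (hZ k v)
  zero_mem' k v := by simp
  smul_mem' c Z hZ k v := by
    change 0 ≤ v ⬝ᵥ ((c : ℝ) • Z.1 k) *ᵥ v
    rw [Matrix.smul_mulVec, dotProduct_smul]
    exact mul_nonneg c.2 (hZ k v)

/-- An order unit must absorb nonsymmetric matrices too, so duality runs over `formCone`. Symmetric
data make the passage back to semidefinite matrices harmless. -/
theorem trace_mul_symmetrize {A : Matrix (Fin n) (Fin n) ℝ} (hA : A.IsSymm)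
    (P : Matrix (Fin n) (Fin n) ℝ) :
    (A * ((1 / 2 : ℝ) • (P + Pᵀ))ᵀ).trace = (A * Pᵀ).trace := by
  have h : (A * P).trace = (A * Pᵀ).trace := by
    rw [← Matrix.trace_transpose (A * P), Matrix.transpose_mul, hA.eq, Matrix.trace_mul_comm]
  rw [Matrix.transpose_smul, Matrix.transpose_add, Matrix.transpose_transpose, Matrix.mul_smul,
    Matrix.mul_add, Matrix.trace_smul, Matrix.trace_add, h, smul_eq_mul]
  ring

theorem posSemidef_symmetrize {P : Matrix (Fin n) (Fin n) ℝ} (h : ∀ v, 0 ≤ v ⬝ᵥ P *ᵥ v) :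
    ((1 / 2 : ℝ) • (P + Pᵀ)).PosSemidef := by
  refine .of_dotProduct_mulVec_nonneg ?_ fun v => ?_
  · rw [Matrix.isHermitian_iff_isSymm, Matrix.IsSymm, Matrix.transpose_smul, Matrix.transpose_add,
      Matrix.transpose_transpose, add_comm]
  · have h1 : v ⬝ᵥ Pᵀ *ᵥ v = v ⬝ᵥ P *ᵥ v := by
      rw [Matrix.mulVec_transpose, dotProduct_comm, ← Matrix.dotProduct_mulVec]
    rw [star_trivial, Matrix.smul_mulVec, dotProduct_smul, Matrix.add_mulVec, dotProduct_add, h1]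
    have := h v
    simp only [smul_eq_mul]
    linarith

theorem g₄_eq {Z : Coeffs n} (hlin : ∀ k, 0 ≤ ξ.lin k) (hvec : ∀ k, ξ.lin k = 0 → ξ.vec k = 0) :
    g₄ ξ Z = (pairing (fun k => (1 / ξ.lin k) • Matrix.vecMulVec (ξ.vec k) (ξ.vec k)) ξ.vec ξ.lin
      (Z.P, Z.r, Z.w) : ℝ) := by
  change _ = ((∑ k, _ : ℝ) : EReal)
  rw [coe_sum_ereal]
  refine Finset.sum_congr rfl fun k _ => ?_
  have h : perspective (Z.P k) (ξ.vec k) (ξ.lin k) =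
      ((1 / ξ.lin k * (ξ.vec k ⬝ᵥ Z.P k *ᵥ ξ.vec k) : ℝ) : EReal) := by
    unfold perspective
    split_ifs with h1 h2
    · rfl
    · simp [h2.1]
    · have h0 := le_antisymm (not_lt.1 h1) (hlin k)
      exact absurd ⟨h0, by simp [hvec k h0]⟩ h2
  have h' : (((1 / ξ.lin k) • Matrix.vecMulVec (ξ.vec k) (ξ.vec k)) * (Z.P k)ᵀ).trace =
      1 / ξ.lin k * (ξ.vec k ⬝ᵥ Z.P k *ᵥ ξ.vec k) := by
    rw [Matrix.smul_mul, Matrix.trace_smul, Matrix.vecMulVec_mul, Matrix.trace_vecMulVec,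
      Matrix.vecMul_transpose, smul_eq_mul]
  rw [h, ← EReal.coe_add, h', add_assoc]

/-- The perspective at `Z₀` must be finite, which excludes `t < 0`; at `t = 0` it requires `vᵀP₀v =
0`, and `P₀ ⪰ 1` then gives `v = 0`. -/
theorem vec_lin_of_worstCase_lt_top (hξ : worstCase D ξ < ⊤) {Z₀ : Coeffs n}
    (hZ₀ : Z₀ ∈ D.feasibleSet) (hint : ∀ k, (Z₀.P k - 1).PosSemidef) (k : Factor n) :
    0 ≤ ξ.lin k ∧ (ξ.lin k = 0 → ξ.vec k = 0) := by
  have h := perspective_ne_top_of_g₄ (ξ := ξ) (Z := Z₀)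
    ((le_iSup₂ (f := fun Z _ => g₄ ξ Z) Z₀ hZ₀).trans_lt hξ).ne k
  unfold perspective at h
  split_ifs at h with h1 h2
  · exact ⟨h1.le, fun h0 => absurd h0 h1.ne'⟩
  · refine ⟨h2.1.ge, fun _ => ?_⟩
    have h3 := dotProduct_mulVec_nonneg (hint k) (ξ.vec k)
    rw [Matrix.sub_mulVec, Matrix.one_mulVec, dotProduct_sub, h2.2, zero_sub] at h3
    have h4 : 0 ≤ ξ.vec k ⬝ᵥ ξ.vec k := by simpa using dotProduct_star_self_nonneg (ξ.vec k)
    exact dotProduct_self_eq_zero.1 (by linarith)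
  · exact absurd rfl h

/-- The dual of the inner problem attains a value that is at most the worst case. -/
theorem exists_isSDPFeasible_le_worstCase [Fintype ι] (hsymm : ∀ l k, (D.A l k).IsSymm)
    {Z₀ : Coeffs n} (hZ₀ : Z₀ ∈ D.feasibleSet) (hint : ∀ k, (Z₀.P k - 1).PosSemidef)
    (hX : ξ ∈ X) (hξ : worstCase D ξ < ⊤) :
    ∃ S lam, IsSDPFeasible D X ξ S lam ∧
      ((-∑ l, lam l * D.q l : ℝ) : EReal) ≤ worstCase D ξ := by
  have hlin k := (vec_lin_of_worstCase_lt_top hξ hZ₀ hint k).1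
  have hvec k := (vec_lin_of_worstCase_lt_top hξ hZ₀ hint k).2
  -- The least matrix that the bordered LMI permits.
  set S : Factor n → Matrix (Fin n) (Fin n) ℝ :=
    fun k => (1 / ξ.lin k) • Matrix.vecMulVec (ξ.vec k) (ξ.vec k) with hS
  have hSsymm (k) : (S k).IsSymm := by
    simp [hS, Matrix.IsSymm, Matrix.transpose_vecMulVec]
  have hle (Z : Coeffs n) (hZ : Z ∈ D.feasibleSet) :
      (pairing S ξ.vec ξ.lin (Z.P, Z.r, Z.w) : EReal) ≤ worstCase D ξ := by
    rw [hS, ← g₄_eq hlin hvec]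
    exact le_iSup₂ (f := fun Z _ => g₄ ξ Z) Z hZ
  obtain ⟨s, hs⟩ : ∃ s : ℝ, worstCase D ξ = s :=
    ⟨_, (EReal.coe_toReal hξ.ne ((EReal.bot_lt_coe _).trans_le (hle Z₀ hZ₀)).ne').symm⟩
  simp only [hs, EReal.coe_le_coe_iff] at hle ⊢
  obtain ⟨lam, hq, hlam⟩ := exists_dual_of_forall_le (formCone n)
    (fun l => pairing (D.A l) (D.c l) (D.μ l)) D.q (pairing S ξ.vec ξ.lin) s (Z₀.P, Z₀.r, Z₀.w)
    (fun k => dotProduct_mulVec_nonneg (hZ₀.2 k)) hZ₀.1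
    (fun Z => exists_smul_add_form_nonneg hint Z.1) (by
      rintro ⟨P, r, w⟩ hZ hq
      have hsym {A c μ} (hA : ∀ k, Matrix.IsSymm (A k)) :
          pairing A c μ (fun k => (1 / 2 : ℝ) • (P k + (P k)ᵀ), r, w) = pairing A c μ (P, r, w) :=
        Finset.sum_congr rfl fun k _ => by simp only [trace_mul_symmetrize (hA k)]
      rw [← hsym hSsymm]
      exact hle ⟨_, r, w⟩ ⟨fun l => (hsym (hsymm l)).trans (hq l),
        fun k => posSemidef_symmetrize (hZ k)⟩)
  -- The SDP adds the multiplier terms, hence the sign change. Its constraints follow by testing the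
  -- dual inequality on rank-one matrices and on the free directions `r` and `w`.
  refine ⟨S, fun l => -lam l, ⟨fun k => ?_, fun k => ?_, fun k => ?_, fun k =>
    posSemidef_bordered (hlin k) (hvec k), hX⟩, by simpa using hq⟩
  · have hp (A : Factor n → Matrix (Fin n) (Fin n) ℝ) (c μ) (b : Fin n → ℝ) :
        pairing A c μ (Pi.single k (Matrix.vecMulVec b b), 0, 0) = b ⬝ᵥ A k *ᵥ b := by
      refine (Finset.sum_eq_single k (fun l _ hl => by simp [hl]) (by simp)).trans ?_
      simpa using trace_mul_vecMulVec (A k) b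
    refine .of_dotProduct_mulVec_nonneg ?_ fun b => ?_
    · rw [Matrix.isHermitian_iff_isSymm, Matrix.IsSymm]
      simp [Matrix.transpose_sum, (hSsymm k).eq, fun l => (hsymm l k).eq]
    · have h := hlam (Pi.single k (Matrix.vecMulVec b b), 0, 0) fun l v => by
        by_cases hl : l = k
        · subst hl
          simpa using dotProduct_mulVec_nonneg (Matrix.posSemidef_vecMulVec_self_star b) v
        · simp [hl]
      simp only [hp] at h
      simp [Matrix.neg_mulVec, Matrix.add_mulVec, Matrix.sum_mulVec, Matrix.smul_mulVec,
        dotProduct_sum]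
      linarith
  · have hp (A : Factor n → Matrix (Fin n) (Fin n) ℝ) (c μ) (b : Fin n → ℝ) :
        pairing A c μ (0, Pi.single k b, 0) = c k ⬝ᵥ b := by
      refine (Finset.sum_eq_single k (fun l _ hl => by simp [hl]) (by simp)).trans ?_
      simp
    -- Testing on the residual itself gives `uᵀu ≤ 0`.
    set u := ξ.vec k + ∑ l, -lam l • D.c l k with hu
    have h := hlam (0, Pi.single k u, 0) fun l v => by simp
    simp only [hp] at h
    have h1 : u ⬝ᵥ u = ξ.vec k ⬝ᵥ u - ∑ l, lam l * (D.c l k ⬝ᵥ u) := by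
      conv_lhs => arg 1; rw [hu]
      simp [add_dotProduct, sum_dotProduct, sub_eq_add_neg]
    have h2 : 0 ≤ u ⬝ᵥ u := by simpa using dotProduct_star_self_nonneg u
    exact dotProduct_self_eq_zero.1 (by linarith)
  · have hp (A : Factor n → Matrix (Fin n) (Fin n) ℝ) (c μ) (b : ℝ) :
        pairing A c μ (0, 0, Pi.single k b) = μ k * b := by
      refine (Finset.sum_eq_single k (fun l _ hl => by simp [hl]) (by simp)).trans ?_
      simp
    have h1 := hlam (0, 0, Pi.single k 1) fun l v => by simp
    have h2 := hlam (0, 0, Pi.single k (-1)) fun l v => by simp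
    simp only [hp, mul_one, mul_neg, Finset.sum_neg_distrib] at h1 h2
    simp only [neg_mul, Finset.sum_neg_distrib]
    linarith

end SLC

theorem mainTheorem4 {n : ℕ} (p : MvPolynomial (Fin n) ℝ) (hp : p.totalDegree ≤ 4)
    {ι : Type*} [Fintype ι] (D : SLC.LinearSystem n ι)
    (hsymm : ∀ l k, (D.A l k).IsSymm)
    (hD : ∀ Z : SLC.Coeffs n, Z ∈ D.feasibleSet ↔ Z.IsDecomposition p)
    (X : Set (SLC.LiftedPoint n)) (ξ : SLC.LiftedPoint n) :
    SLC.IsMinMaxOptimal D X ξ ↔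
      ∃ (S : SLC.Factor n → Matrix (Fin n) (Fin n) ℝ) (lam : ι → ℝ),
        SLC.IsSDPOptimal D X ξ S lam := by
  obtain ⟨Z₀, hZ₀, hint⟩ := SLC.exists_isDecomposition_sub_one p hp
  replace hZ₀ := (hD Z₀).2 hZ₀
  constructor
  · rintro ⟨hX, htop, hmin⟩
    obtain ⟨S, lam, hfeas, hle⟩ :=
      SLC.exists_isSDPFeasible_le_worstCase hsymm hZ₀ hint hX htop
    exact ⟨S, lam, hfeas, fun ξ' S' lam' h' => EReal.coe_le_coe_iff.1
      (hle.trans ((hmin ξ' h'.mem).trans h'.worstCase_le))⟩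
  · rintro ⟨S, lam, hfeas, hmin⟩
    refine ⟨hfeas.mem, hfeas.worstCase_le.trans_lt (EReal.coe_lt_top _), fun η hη => ?_⟩
    -- Only competitors with a finite worst case matter, and those have an SDP-feasible completion
    -- of no larger value.
    rcases eq_or_ne (SLC.worstCase D η) ⊤ with htop | htop
    · exact htop ▸ le_top
    · obtain ⟨S', lam', hfeas', hle⟩ :=
        SLC.exists_isSDPFeasible_le_worstCase hsymm hZ₀ hint hη (lt_top_iff_ne_top.2 htop)
      exact hfeas.worstCase_le.trans
        ((EReal.coe_le_coe_iff.2 (hmin η S' lam' hfeas')).trans hle)
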